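/- Let $n \ge 0$. Let $G$ be a $\mathrm{GBS}_n$ group, that is, the fundamental group of a finite (connected) graph of groups all of whose vertex and edge groups are isomorphic to $\mathbb{Z}^n$. Let $S(G)$ be the sphere of classes $[\varphi]$ of non-zero homomorphisms $\varphi : G \to \mathbb{R}$, where $[\varphi]=[\psi]$ if and only if $\varphi=\lambda\psi$ for some real $\lambda>0$. Let $\Sigma(G)\subseteq S(G)$ be the Bieri–Neumann–Strebel invariant: $[\varphi]\in\Sigma(G)$ if and only if, for some (equivalently, every) finite generating set $\mathcal{G}$ of $G$, the subgraph of the Cayley graph of $G$ with respect to $\mathcal{G}$ (with edges joining $g$ to $ga$, $a\in\mathcal{G}$) induced on the vertices $g$ with $\varphi(g)\ge 0$ is connected. For $H \subseteq G$ let $S(G,H)=\{[\varphi]\in S(G) : H\subseteq\ker\varphi\}$, and let $S(G,H)^c$ be its complement in $S(G)$. If $G$ is non-solvable and unimodular, i.e. some subgroup of finite index in $G$ is isomorphic to $\mathbb{Z}^n\times\mathbb{F}_k$ for some $k\ge 2$ (where $\mathbb{F}_k$ is the free group of rank $k$), then $$\Sigma(G)=S(G,Z(G))^c,$$ where $Z(G)$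 is the center of $G$. In other words, for a non-zero homomorphism $\varphi:G\to\mathbb{R}$, $[\varphi]\in\Sigma(G)$ if and only if $\varphi(Z(G))\neq 0$. -/

import Mathlib

/-! ## The character sphere and the Bieri-Neumann-Strebel invariant -/

/-- The sphere `S(G)`: classes of non-zero homomorphisms `φ : G → ℝ`, where `[φ] = [ψ]` if and only
if `φ = c • ψ` for some real `c > 0`. A homomorphism from the multiplicative group `G` to the
additive group `ℝ` is written as an element of the real vector space `Additive G →+ ℝ`. -/
abbrev CharacterSphere (G : Type*) [Group G] : Type _ :=
  Module.Ray ℝ (Additive G →+ ℝ)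

/-- The vertex set `φ⁻¹([0, ∞))` of the non-negative part of a Cayley graph. -/
def nonnegPart {G : Type*} [Group G] (φ : Additive G →+ ℝ) : Set G :=
  {g | 0 ≤ φ (Additive.ofMul g)}

/-- For some finite generating set `A` of `G`, the full subgraph of the Cayley graph of `G` with
respect to `A` on the vertices `g` with `φ g ≥ 0` is connected. (Edges of the Cayley graph join
`g` to `g * a` for `a ∈ A`.) -/
def HasConnectedNonnegPart {G : Type*} [Group G] (φ : Additive G →+ ℝ) : Prop :=
  ∃ A : Finset G, Subgroup.closure (A : Set G) = ⊤ ∧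
    ((SimpleGraph.mulCayley (A : Set G)).induce (nonnegPart φ)).Connected

/-- The Bieri-Neumann-Strebel invariant `Σ(G) ⊆ S(G)`. -/
def bnsInvariant (G : Type*) [Group G] : Set (CharacterSphere G) :=
  {x | ∃ (φ : Additive G →+ ℝ) (hφ : φ ≠ 0), x = rayOfNeZero ℝ φ hφ ∧ HasConnectedNonnegPart φ}

/-- The subsphere `S(G, H) = {[φ] ∈ S(G) | H ⊆ ker φ}`. -/
def subsphere (G : Type*) [Group G] (H : Set G) : Set (CharacterSphere G) :=
  {x | ∃ (φ : Additive G →+ ℝ) (hφ : φ ≠ 0), x = rayOfNeZero ℝ φ hφ ∧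
    ∀ h ∈ H, φ (Additive.ofMul h) = 0}

theorem exists_pos_smul_of_ray_eq {G : Type*} [Group G] {φ ψ : Additive G →+ ℝ} {hφ : φ ≠ 0}
    {hψ : ψ ≠ 0} (h : rayOfNeZero ℝ φ hφ = rayOfNeZero ℝ ψ hψ) :
    ∃ c : ℝ, 0 < c ∧ φ = c • ψ := by
  obtain ⟨c, hc, e⟩ := ((ray_eq_iff hφ hψ).1 h).symm.exists_pos_left hψ hφ
  exact ⟨c, hc, e.symm⟩

/-- Membership in `Σ(G)` may be tested on any representative of the class. -/
theorem mem_bnsInvariant_iff {G : Type*} [Group G] (φ : Additive G →+ ℝ) (hφ : φ ≠ 0) :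
    rayOfNeZero ℝ φ hφ ∈ bnsInvariant G ↔ HasConnectedNonnegPart φ := by
  refine ⟨?_, fun h => ⟨φ, hφ, rfl, h⟩⟩
  rintro ⟨ψ, hψ, e, A, hA, hc⟩
  obtain ⟨c, hc0, rfl⟩ := exists_pos_smul_of_ray_eq e
  have : nonnegPart (c • ψ) = nonnegPart ψ := by
    ext g
    simp [nonnegPart, hc0]
  exact ⟨A, hA, by rw [this]; exact hc⟩

/-- Membership in `S(G, H)` may be tested on any representative of the class. -/
theorem mem_subsphere_iff {G : Type*} [Group G] (H : Set G) (φ : Additive G →+ ℝ) (hφ : φ ≠ 0) :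
    rayOfNeZero ℝ φ hφ ∈ subsphere G H ↔ ∀ h ∈ H, φ (Additive.ofMul h) = 0 := by
  refine ⟨?_, fun h => ⟨φ, hφ, rfl, h⟩⟩
  rintro ⟨ψ, hψ, e, h0⟩ h hh
  obtain ⟨c, hc0, rfl⟩ := exists_pos_smul_of_ray_eq e
  simp [h0 h hh]

/-! ## Graphs of groups -/

/-- A graph of groups. Loops and multiple edges are allowed; each geometric edge is listed once,
with a chosen orientation from `src e` to `tgt e`. Both inclusions of the edge groups are
injective. -/
structure GraphOfGroups where
  V : Type
  E : Type
  src : E → V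
  tgt : E → V
  vertexGroup : V → Type
  edgeGroup : E → Type
  [instVertex : ∀ v, Group (vertexGroup v)]
  [instEdge : ∀ e, Group (edgeGroup e)]
  srcHom : ∀ e, edgeGroup e →* vertexGroup (src e)
  tgtHom : ∀ e, edgeGroup e →* vertexGroup (tgt e)
  srcHom_injective : ∀ e, Function.Injective (srcHom e)
  tgtHom_injective : ∀ e, Function.Injective (tgtHom e)

attribute [instance] GraphOfGroups.instVertex GraphOfGroups.instEdge

namespace GraphOfGroups

/-- The set `T` of edges forms, together with all the vertices, a tree: `T` contains no loops and no
two parallel edges, and the resulting simple graph on the vertex set is a tree. -/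
structure IsSpanningTree (Γ : GraphOfGroups) (T : Set Γ.E) : Prop where
  no_loop : ∀ e ∈ T, Γ.src e ≠ Γ.tgt e
  no_parallel : Set.InjOn (fun e => s(Γ.src e, Γ.tgt e)) T
  isTree : (SimpleGraph.fromEdgeSet ((fun e => s(Γ.src e, Γ.tgt e)) '' T)).IsTree

/-- The free product of all the vertex groups and of the free group on the edges. -/
abbrev FreeProd (Γ : GraphOfGroups) : Type :=
  Monoid.Coprod (Monoid.CoprodI Γ.vertexGroup) (FreeGroup Γ.E)

/-- The inclusion of a vertex group in the free product. -/
def ofVertex (Γ : GraphOfGroups) (v : Γ.V) : Γ.vertexGroup v →* Γ.FreeProd :=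
  Monoid.Coprod.inl.comp Monoid.CoprodI.of

/-- The stable letter of an edge. -/
def stableLetter (Γ : GraphOfGroups) (e : Γ.E) : Γ.FreeProd :=
  Monoid.Coprod.inr (FreeGroup.of e)

/-- The relators of the fundamental group: `t_e⁻¹ * a * t_e = a'` when `a` and `a'` are the images
in the source and in the target vertex group of the same element of the edge group of `e`, and
`t_e = 1` when `e` is in the spanning tree `T`. -/
def relators (Γ : GraphOfGroups) (T : Set Γ.E) : Set Γ.FreeProd :=
  {x | ∃ (e : Γ.E) (a : Γ.edgeGroup e),
    x = (Γ.stableLetter e)⁻¹ * Γ.ofVertex (Γ.src e) (Γ.srcHom e a) * Γ.stableLetter e *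
      (Γ.ofVertex (Γ.tgt e) (Γ.tgtHom e a))⁻¹} ∪
  {x | ∃ e ∈ T, x = Γ.stableLetter e}

/-- The fundamental group of a graph of groups relative to a spanning tree `T`. -/
abbrev FundamentalGroup (Γ : GraphOfGroups) (T : Set Γ.E) : Type :=
  Γ.FreeProd ⧸ Subgroup.normalClosure (Γ.relators T)

end GraphOfGroups

/-! ## Generalized Baumslag-Solitar groups -/

/-- The group `ℤⁿ`, written multiplicatively. -/
abbrev FreeAbelian (n : ℕ) : Type := Multiplicative (Fin n → ℤ)

/-- `G` is a `GBS_n` group: it is the fundamental group of a finite (connected) graph of groups all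
of whose vertex and edge groups are isomorphic to `ℤⁿ`. -/
def IsGBS (n : ℕ) (G : Type*) [Group G] : Prop :=
  ∃ (Γ : GraphOfGroups) (T : Set Γ.E),
    Finite Γ.V ∧ Finite Γ.E ∧ Γ.IsSpanningTree T ∧
    (∀ v, Nonempty (Γ.vertexGroup v ≃* FreeAbelian n)) ∧
    (∀ e, Nonempty (Γ.edgeGroup e ≃* FreeAbelian n)) ∧
    Nonempty (G ≃* Γ.FundamentalGroup T)

/-- `G` is virtually `ℤⁿ × F_k` for some `k ≥ 2`: some subgroup of finite index is isomorphic to the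
product of `ℤⁿ` with a free group of finite rank `k ≥ 2`. For a non-solvable `GBS_n` group this is
what being unimodular means. -/
def IsVirtuallyFreeAbelianTimesFree (n : ℕ) (G : Type*) [Group G] : Prop :=
  ∃ k : ℕ, 2 ≤ k ∧ ∃ H : Subgroup G, H.FiniteIndex ∧
    Nonempty (H ≃* FreeAbelian n × FreeGroup (Fin k))

/-!
Let `H` be a subgroup of finite index in `G` with `H ≃ ℤⁿ × F_k`, `k ≥ 2`.

If `φ z ≠ 0` for a central `z`, put `z` into a finite generating set. A path of the Cayley graph from
`1` to `g` can be translated by a high power of `z` so that it lies in `φ ≥ 0`, and its endpoints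
`z ^ m` and `z ^ m * g = g * z ^ m` are joined to `1` and `g` along powers of `z`
(`hasConnectedNonnegPart_of_mem_center`).

Suppose now that `φ` vanishes on the center of `G`. The finite group `G / H.normalCore` acts by
conjugation on the center of `H.normalCore`, which contains a power of every central element of `H`.
The product of an orbit is central in `G`, and `φ` is constant on orbits, so `φ` vanishes on the
center of `H` (`apply_eq_zero_of_commute_of_finiteIndex`). Hence `φ` restricted to `H` comes from a
non-zero character of `F_k`. A coarse form of connectedness of `φ ≥ 0`, namely `IsCoarselyConnected`,
does not refer to a generating set, and passes to subgroups of finite index and to quotients. It fails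
for every non-zero character of `F_k`: the Cayley graph of `F_k` is a tree, and its geodesic from `1`
to `u ^ N * v * u⁻¹ ^ N` descends to `φ (u ^ N)`, which is as low as desired for a letter `u` with
`φ u < 0` (`FreeGroup.not_isCoarselyConnected`).
-/

open Relation

/-! ### Characters that do not vanish on the center -/

section Central

variable {G : Type*} [Group G]

theorem ofMul_pow_apply (φ : Additive G →+ ℝ) (g : G) (m : ℕ) :
    φ (Additive.ofMul (g ^ m)) = m * φ (Additive.ofMul g) := by
  rw [ofMul_pow, map_nsmul, nsmul_eq_mul]

/-- `x` and `y` lie in the non-negative part of the Cayley graph with respect to `A`, and are joined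
by a path in it. -/
def JoinedNonneg (φ : Additive G →+ ℝ) (A : Set G) (x y : G) : Prop :=
  ∃ (hx : x ∈ nonnegPart φ) (hy : y ∈ nonnegPart φ),
    ((SimpleGraph.mulCayley A).induce (nonnegPart φ)).Reachable ⟨x, hx⟩ ⟨y, hy⟩

namespace JoinedNonneg

variable {φ : Additive G →+ ℝ} {A : Set G} {x y z : G}

theorem refl (hx : x ∈ nonnegPart φ) : JoinedNonneg φ A x x := ⟨hx, hx, .rfl⟩

theorem symm : JoinedNonneg φ A x y → JoinedNonneg φ A y x :=
  fun ⟨hx, hy, h⟩ => ⟨hy, hx, h.symm⟩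

theorem trans : JoinedNonneg φ A x y → JoinedNonneg φ A y z → JoinedNonneg φ A x z :=
  fun ⟨hx, _, h⟩ ⟨_, hz, h'⟩ => ⟨hx, hz, h.trans h'⟩

theorem mul_right {a : G} (ha : a ∈ A) (hx : x ∈ nonnegPart φ) (hxa : x * a ∈ nonnegPart φ) :
    JoinedNonneg φ A x (x * a) := by
  refine ⟨hx, hxa, ?_⟩
  by_cases h : x = x * a
  · have : (⟨x, hx⟩ : nonnegPart φ) = ⟨x * a, hxa⟩ := Subtype.ext h
    rw [this]
  · apply SimpleGraph.Adj.reachable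
    rw [SimpleGraph.comap_adj, SimpleGraph.mulCayley_adj']
    exact ⟨h, a, ha, Or.inl rfl⟩

theorem mul_pow {a : G} (ha : a ∈ A) (hx : x ∈ nonnegPart φ) (h0 : 0 ≤ φ (Additive.ofMul a))
    (m : ℕ) : JoinedNonneg φ A x (x * a ^ m) := by
  induction m with
  | zero => simpa using refl hx
  | succ m ih =>
    refine ih.trans ?_
    obtain ⟨-, hy, -⟩ := ih
    rw [pow_succ, ← mul_assoc]
    refine mul_right ha hy ?_
    simp only [nonnegPart, Set.mem_ofPred_eq, ofMul_mul, map_add] at hy ⊢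
    linarith

/-- A path of the Cayley graph starting at `1`, translated by a high power of `a`, lies in the
non-negative part. -/
theorem eventually_pow_mul {a : G} (h0 : 0 < φ (Additive.ofMul a)) {w : G}
    (hw : w ∈ Subgroup.closure A) : ∃ N : ℕ, ∀ m ≥ N, JoinedNonneg φ A (a ^ m) (a ^ m * w) := by
  have large : ∀ v : G, ∃ N : ℕ, ∀ m ≥ N, a ^ m * v ∈ nonnegPart φ := by
    intro v
    obtain ⟨N, hN⟩ := Archimedean.arch (-φ (Additive.ofMul v)) h0
    refine ⟨N, fun m hm => ?_⟩
    have : (N : ℝ) * φ (Additive.ofMul a) ≤ m * φ (Additive.ofMul a) := by gcongr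
    simp only [nonnegPart, Set.mem_ofPred_eq, ofMul_mul, map_add, ofMul_pow_apply]
    rw [nsmul_eq_mul] at hN
    linarith
  induction hw using Subgroup.closure_induction_right with
  | one =>
    obtain ⟨N, hN⟩ := large 1
    exact ⟨N, fun m hm => by simpa using refl (by simpa using hN m hm)⟩
  | mul_right x hx y hy ih =>
    obtain ⟨N, hN⟩ := ih
    obtain ⟨M, hM⟩ := large (x * y)
    refine ⟨max N M, fun m hm => ?_⟩
    have h := hN m (le_of_max_le_left hm)
    have h' := hM m (le_of_max_le_right hm)
    rw [← mul_assoc] at h' ⊢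
    exact h.trans (mul_right hy h.2.1 h')
  | mul_inv_cancel x hx y hy ih =>
    obtain ⟨N, hN⟩ := ih
    obtain ⟨M, hM⟩ := large (x * y⁻¹)
    refine ⟨max N M, fun m hm => ?_⟩
    have h := hN m (le_of_max_le_left hm)
    have h' := hM m (le_of_max_le_right hm)
    have := mul_right (x := a ^ m * (x * y⁻¹)) hy h' (by simpa [mul_assoc] using h.2.1)
    exact h.trans (by simpa [mul_assoc] using this.symm)

end JoinedNonneg

theorem hasConnectedNonnegPart_of_mem_center [hG : Group.FG G] {φ : Additive G →+ ℝ} {z : G}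
    (hz : z ∈ Subgroup.center G) (h : φ (Additive.ofMul z) ≠ 0) : HasConnectedNonnegPart φ := by
  classical
  wlog h0 : 0 < φ (Additive.ofMul z) generalizing z with self
  · have := lt_of_le_of_ne (not_lt.1 h0) h
    exact self (inv_mem hz) (by simpa using h) (by simpa using this)
  obtain ⟨S, hS⟩ := Group.fg_def.1 hG
  refine ⟨insert z S, ?_, ?_⟩
  · rw [eq_top_iff, ← hS]
    exact Subgroup.closure_mono (by simp)
  have h1 : (1 : G) ∈ nonnegPart φ := by simp [nonnegPart]
  have key : ∀ g ∈ nonnegPart φ, JoinedNonneg φ (insert z S : Finset G) 1 g := by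
    intro g hg
    have hzA : z ∈ ((insert z S : Finset G) : Set G) := by simp
    have hgA : g ∈ Subgroup.closure ((insert z S : Finset G) : Set G) :=
      Subgroup.closure_mono (by simp) (hS ▸ Subgroup.mem_top g)
    obtain ⟨N, hN⟩ := JoinedNonneg.eventually_pow_mul h0 hgA
    have a := JoinedNonneg.mul_pow hzA h1 h0.le N
    rw [one_mul] at a
    have b := hN N le_rfl
    rw [← Subgroup.mem_center_iff.1 (pow_mem hz N) g] at b
    exact (a.trans b).trans (JoinedNonneg.mul_pow hzA hg h0.le N).symm
  have : Nonempty (nonnegPart φ) := ⟨⟨1, h1⟩⟩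
  refine ⟨fun x y => ?_⟩
  obtain ⟨_, _, e⟩ := (key x x.2).symm.trans (key y y.2)
  exact e

end Central

/-! ### Subgroups of finite index -/

section FiniteIndex

variable {G : Type*} [Group G] (H : Subgroup G)

/-- A map `g ↦ g * r g` of `G` onto a subgroup `H` of finite index that fixes `H` pointwise and moves
every element by one of finitely many right factors. -/
theorem Subgroup.exists_finite_range_mul_mem [H.FiniteIndex] :
    ∃ r : G → G, (Set.range r).Finite ∧ (∀ g, g * r g ∈ H) ∧ ∀ h ∈ H, r h = 1 := by
  classical
  refine ⟨fun g => if g ∈ H then 1 else (QuotientGroup.mk g⁻¹ : G ⧸ H).out, ?_, ?_, ?_⟩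
  · refine ((Set.finite_range fun q : G ⧸ H => q.out).insert 1).subset ?_
    rintro _ ⟨g, rfl⟩
    dsimp only
    split_ifs
    · exact Or.inl rfl
    · exact Or.inr ⟨_, rfl⟩
  · intro g
    dsimp only
    split_ifs with hg
    · simpa using hg
    · obtain ⟨h, e⟩ := QuotientGroup.mk_out_eq_mul H g⁻¹
      rw [e]
      simp
  · intro h hh
    simp [hh]

theorem Group.fg_of_finiteIndex [H.FiniteIndex] [hH : Group.FG H] : Group.FG G := by
  obtain ⟨S, hS, hfin⟩ := Group.fg_iff.1 hH
  obtain ⟨r, hr, hrH, -⟩ := H.exists_finite_range_mul_mem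
  refine Group.fg_iff.2 ⟨H.subtype '' S ∪ Set.range r, ?_, (hfin.image _).union hr⟩
  rw [eq_top_iff]
  intro g _
  have h1 : g * r g ∈ Subgroup.closure (H.subtype '' S ∪ Set.range r) := by
    refine Subgroup.closure_mono Set.subset_union_left ?_
    rw [← MonoidHom.map_closure, hS]
    exact ⟨⟨_, hrH g⟩, trivial, rfl⟩
  have h2 : r g ∈ Subgroup.closure (H.subtype '' S ∪ Set.range r) :=
    Subgroup.subset_closure (Or.inr ⟨g, rfl⟩)
  simpa using mul_mem h1 (inv_mem h2)

/-- The product of the `G`-conjugates of an element of the center of a normal subgroup `N` of finite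
index is central in `G`, so a character that vanishes on the center of `G` vanishes on the center of
`N`. -/
theorem apply_eq_zero_of_commute_of_normal (N : Subgroup G) [N.Normal] [N.FiniteIndex]
    {φ : Additive G →+ ℝ} (hφ : ∀ z ∈ Subgroup.center G, φ (Additive.ofMul z) = 0) {c : G}
    (hc : c ∈ N) (hcomm : ∀ x ∈ N, Commute x c) : φ (Additive.ofMul c) = 0 := by
  classical
  let Z : Subgroup G := (Subgroup.center N).map N.subtype
  have hZ : ∀ x y : Z, x * y = y * x := by
    rintro ⟨_, x, hx, rfl⟩ ⟨_, y, hy, rfl⟩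
    exact Subtype.ext (congrArg N.subtype (Subgroup.mem_center_iff.1 hy x))
  let _ : CommGroup Z := { (inferInstance : Group Z) with mul_comm := hZ }
  have : Fintype (G ⧸ N) := Fintype.ofFinite _
  have hcZ : c ∈ Z := by
    refine ⟨⟨c, hc⟩, Subgroup.mem_center_iff.2 fun x => Subtype.ext (hcomm x x.2).eq, rfl⟩
  have hn : Z.Normal := inferInstance
  let conj : G → Z := fun g => ⟨g * c * g⁻¹, hn.conj_mem c hcZ g⟩
  have hconj : ∀ a b : G, QuotientGroup.leftRel N a b → conj a = conj b := by
    intro a b hab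
    have e := (hcomm _ (QuotientGroup.leftRel_apply.1 hab)).eq
    refine Subtype.ext ?_
    change a * c * a⁻¹ = b * c * b⁻¹
    calc a * c * a⁻¹ = a * (c * (a⁻¹ * b)) * b⁻¹ := by group
      _ = b * c * b⁻¹ := by rw [← e]; group
  let f : G ⧸ N → Z := fun q => Quotient.liftOn' q conj hconj
  have hf : ∀ (g : G) (q : G ⧸ N), (f (g • q) : G) = g * f q * g⁻¹ := by
    intro g q
    induction q using Quotient.inductionOn' with
    | h a =>
      change (g * a) * c * (g * a)⁻¹ = g * (a * c * a⁻¹) * g⁻¹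
      group
  have hφf : ∀ q, φ (Additive.ofMul (f q : G)) = φ (Additive.ofMul c) := by
    intro q
    induction q using Quotient.inductionOn' with
    | h a =>
      change φ (Additive.ofMul (a * c * a⁻¹)) = _
      simp
  have hcentral : ((∏ q, f q : Z) : G) ∈ Subgroup.center G := by
    rw [Subgroup.mem_center_iff]
    intro g
    let cg : Z →* Z := (MulAut.conjNormal (H := Z) g).toMonoidHom
    have e : cg (∏ q, f q) = ∏ q, f q := by
      rw [map_prod, ← Equiv.prod_comp (MulAction.toPerm g : Equiv.Perm (G ⧸ N)) f]
      refine Finset.prod_congr rfl fun q _ => Subtype.ext ?_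
      exact (MulAut.conjNormal_apply g (f q)).trans (hf g q).symm
    have e' := (MulAut.conjNormal_apply g (∏ q, f q)).symm.trans (congrArg Subtype.val e)
    exact mul_inv_eq_iff_eq_mul.1 e'
  have h0 := hφ _ hcentral
  let ψ : Z →* Multiplicative ℝ := (AddMonoidHom.toMultiplicativeRight φ).comp Z.subtype
  have h1 : ψ (∏ q, f q) = ∏ q, ψ (f q) := map_prod ψ f _
  have h2 : φ (Additive.ofMul ((∏ q, f q : Z) : G)) = ∑ q, φ (Additive.ofMul (f q : G)) := h1
  rw [h0, Finset.sum_congr rfl fun q _ => hφf q, Finset.sum_const, nsmul_eq_mul] at h2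
  have hcard : ((Finset.univ : Finset (G ⧸ N)).card : ℝ) ≠ 0 := by
    rw [Finset.card_univ]
    exact_mod_cast Fintype.card_ne_zero
  exact (mul_eq_zero.1 h2.symm).resolve_left hcard

/-- A character that vanishes on the center of `G` vanishes on every element that commutes with a
subgroup of finite index: some power of it lies in the center of the normal core. -/
theorem apply_eq_zero_of_commute_of_finiteIndex [H.FiniteIndex] {φ : Additive G →+ ℝ}
    (hφ : ∀ z ∈ Subgroup.center G, φ (Additive.ofMul z) = 0) {c : G}
    (hcomm : ∀ x ∈ H, Commute x c) : φ (Additive.ofMul c) = 0 := by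
  obtain ⟨m, hm, -, hmem⟩ := Subgroup.exists_pow_mem_of_index_ne_zero
    (Subgroup.FiniteIndex.index_ne_zero (H := H.normalCore)) c
  have h := apply_eq_zero_of_commute_of_normal H.normalCore hφ hmem
    fun x hx => (hcomm x (H.normalCore_le hx)).pow_right m
  rw [ofMul_pow_apply] at h
  exact (mul_eq_zero.1 h).resolve_left (by exact_mod_cast hm.ne')

end FiniteIndex

/-! ### Coarse connectedness -/

section Coarse

open scoped Pointwise

variable {G : Type*} [Group G]

/-- For some finite set `B` of steps and some lower bound `C`, every `g` with `φ g ≥ 0` is reached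
from `1` by right multiplications by elements of `B` along points with `φ ≥ C`. Unlike in
`HasConnectedNonnegPart`, `B` is not asked to generate, steps are directed, and the path may leave
`φ ≥ 0` by a bounded amount. -/
def IsCoarselyConnected (φ : Additive G →+ ℝ) : Prop :=
  ∃ (B : Set G) (C : ℝ), B.Finite ∧ ∀ g, 0 ≤ φ (Additive.ofMul g) →
    ReflTransGen (fun x y => x⁻¹ * y ∈ B ∧ C ≤ φ (Additive.ofMul y)) 1 g

theorem HasConnectedNonnegPart.isCoarselyConnected {φ : Additive G →+ ℝ}
    (h : HasConnectedNonnegPart φ) : IsCoarselyConnected φ := by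
  obtain ⟨A, -, hc⟩ := h
  refine ⟨A ∪ (A : Set G)⁻¹, 0, A.finite_toSet.union A.finite_toSet.inv, fun g hg => ?_⟩
  have h1 : (1 : G) ∈ nonnegPart φ := by simp [nonnegPart]
  have := (SimpleGraph.reachable_iff_reflTransGen _ _).1 (hc.preconnected ⟨1, h1⟩ ⟨g, hg⟩)
  refine this.lift Subtype.val ?_
  rintro ⟨x, hx⟩ ⟨y, hy⟩ hxy
  rw [SimpleGraph.comap_adj, SimpleGraph.mulCayley_adj'] at hxy
  refine ⟨?_, hy⟩
  obtain ⟨-, a, ha, rfl | rfl⟩ := hxy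
  · exact Or.inl (by simpa using ha)
  · exact Or.inr (by simpa using ha)

theorem IsCoarselyConnected.subgroup {φ : Additive G →+ ℝ} (h : IsCoarselyConnected φ)
    (H : Subgroup G) [H.FiniteIndex] :
    IsCoarselyConnected (φ.comp (MonoidHom.toAdditive H.subtype)) := by
  obtain ⟨B, C, hB, h⟩ := h
  obtain ⟨r, hr, hrH, hr1⟩ := H.exists_finite_range_mul_mem
  obtain ⟨K, hK⟩ := (hr.image fun g => φ (Additive.ofMul g)).bddBelow
  -- The map `g ↦ g * r g` carries paths of `G` to paths of `H`.
  refine ⟨H.subtype ⁻¹' ((Set.range r)⁻¹ * B * Set.range r), C + K,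
    ((hr.inv.mul hB).mul hr).preimage H.subtype_injective.injOn, fun g hg => ?_⟩
  have := (h g hg).lift (fun x => (⟨x * r x, hrH x⟩ : H))
    (p := fun x y => x⁻¹ * y ∈ H.subtype ⁻¹' ((Set.range r)⁻¹ * B * Set.range r) ∧
      C + K ≤ φ.comp (MonoidHom.toAdditive H.subtype) (Additive.ofMul y)) ?_
  · have e1 : (⟨1 * r 1, hrH 1⟩ : H) = 1 := Subtype.ext (by simp [hr1 1 H.one_mem])
    have eg : (⟨g * r g, hrH g⟩ : H) = g := Subtype.ext (by simp [hr1 g g.2])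
    simpa only [Function.onFun, e1, eg] using this
  rintro x y ⟨hxy, hy⟩
  constructor
  · refine ⟨(r x)⁻¹ * (x⁻¹ * y), ⟨(r x)⁻¹, ⟨x, by simp⟩, _, hxy, rfl⟩, r y, ⟨y, rfl⟩, ?_⟩
    simp [mul_assoc]
  · have hk : K ≤ φ (Additive.ofMul (r y)) := hK ⟨r y, ⟨y, rfl⟩, rfl⟩
    change C + K ≤ φ (Additive.ofMul (y * r y))
    rw [ofMul_mul, map_add]
    linarith

theorem IsCoarselyConnected.of_surjective {Q : Type*} [Group Q] {φ : Additive G →+ ℝ}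
    (h : IsCoarselyConnected φ) {f : G →* Q} (hf : Function.Surjective f) {ψ : Additive Q →+ ℝ}
    (hψ : ∀ g, ψ (Additive.ofMul (f g)) = φ (Additive.ofMul g)) : IsCoarselyConnected ψ := by
  obtain ⟨B, C, hB, h⟩ := h
  refine ⟨f '' B, C, hB.image f, fun q hq => ?_⟩
  obtain ⟨g, rfl⟩ := hf q
  rw [hψ] at hq
  have := (h g hq).lift f (p := fun x y => x⁻¹ * y ∈ f '' B ∧ C ≤ ψ (Additive.ofMul y)) ?_
  · simpa only [Function.onFun, map_one] using this
  rintro x y ⟨hxy, hy⟩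
  exact ⟨⟨_, hxy, by simp⟩, by rwa [hψ]⟩

end Coarse

/-! ### Free groups -/

namespace FreeGroup

variable {α : Type*}

/-- In the Cayley tree of a free group, a path from `1` visits every vertex of the geodesic to its
endpoint. -/
theorem Red.exists_prefix_mk_eq {L M : List (α × Bool)} (h : Red L M) {P : List (α × Bool)}
    (hP : P <+: M) : ∃ P', P' <+: L ∧ mk P' = mk P := by
  induction h using Relation.ReflTransGen.head_induction_on with
  | refl => exact ⟨P, hP, rfl⟩
  | head hstep _ ih =>
    obtain ⟨P', hP', e⟩ := ih
    rw [← e]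
    obtain @⟨L₁, L₂, x, b⟩ := hstep
    obtain ⟨R, hR⟩ := hP'
    rcases List.append_eq_append_iff.1 hR with ⟨S, rfl, -⟩ | ⟨S, rfl, rfl⟩
    · exact ⟨P', by simp, rfl⟩
    · exact ⟨L₁ ++ (x, b) :: (x, !b) :: S, by simp, Quot.sound Red.Step.not⟩

/-- A coarse path in a free group, refined to a word in the free generators. -/
theorem exists_word_of_isCoarselyConnected {φ : Additive (FreeGroup α) →+ ℝ}
    (h : IsCoarselyConnected φ) : ∃ C : ℝ, ∀ g, 0 ≤ φ (Additive.ofMul g) →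
      ∃ L, mk L = g ∧ ∀ P, P <+: L → C ≤ φ (Additive.ofMul (mk P)) := by
  classical
  obtain ⟨B, C, hB, h⟩ := h
  have hfin : (⋃ b ∈ B, (fun P => φ (Additive.ofMul (mk P))) '' {P | P <+: b.toWord}).Finite := by
    refine hB.biUnion fun b _ => Set.Finite.image _ ?_
    refine (b.toWord.inits.finite_toSet).subset fun P hP => ?_
    exact (List.mem_inits P _).2 hP
  obtain ⟨K, hK⟩ := hfin.bddBelow
  refine ⟨min 0 C + min 0 K, fun g hg => ?_⟩
  have key : ∃ L, mk L = g ∧ (min 0 C ≤ φ (Additive.ofMul g)) ∧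
      ∀ P, P <+: L → min 0 C + min 0 K ≤ φ (Additive.ofMul (mk P)) := by
    have hpath := h g hg
    clear hg
    induction hpath with
    | refl =>
      refine ⟨[], rfl, by simp, fun P hP => ?_⟩
      rw [List.prefix_nil.1 hP, ← one_eq_mk]
      simpa using add_nonpos (min_le_left 0 C) (min_le_left 0 K)
    | @tail x y _ hxy ih =>
      obtain ⟨L, rfl, hx, hL⟩ := ih
      refine ⟨L ++ ((mk L)⁻¹ * y).toWord, ?_, (min_le_right _ _).trans hxy.2, ?_⟩
      · rw [← mul_mk, mk_toWord, mul_inv_cancel_left]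
      rintro P ⟨R, hR⟩
      rcases List.append_eq_append_iff.1 hR with ⟨S, rfl, -⟩ | ⟨S, rfl, hS⟩
      · exact hL P (by simp)
      · have : K ≤ φ (Additive.ofMul (mk S)) :=
          hK (Set.mem_biUnion hxy.1 ⟨S, ⟨R, hS.symm⟩, rfl⟩)
        have := min_le_right 0 K
        rw [← mul_mk, ofMul_mul, map_add]
        linarith
  obtain ⟨L, e, -, hL⟩ := key
  exact ⟨L, e, hL⟩

theorem isReduced_replicate_append_cons_replicate {x y : α} (hxy : x ≠ y) (b c : Bool) (N : ℕ) :
    IsReduced (List.replicate N (x, b) ++ (y, c) :: List.replicate N (x, !b)) := by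
  have hrep : ∀ b : Bool, IsReduced (List.replicate N (x, b)) :=
    fun b => List.isChain_replicate_of_rel _ fun _ => rfl
  refine List.isChain_append.2 ⟨hrep b, List.isChain_cons.2 ⟨?_, hrep _⟩, ?_⟩
  · rintro a ha e
    rw [List.eq_of_mem_replicate (List.mem_of_mem_head? ha)] at e
    exact absurd e.symm hxy
  · rintro a ha _ ⟨⟩ e
    rw [List.eq_of_mem_replicate (List.mem_of_mem_getLast? ha)] at e
    exact absurd e hxy

theorem not_isCoarselyConnected [Nontrivial α] {φ : Additive (FreeGroup α) →+ ℝ} (hφ : φ ≠ 0) :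
    ¬ IsCoarselyConnected φ := by
  classical
  intro h
  obtain ⟨C, hC⟩ := exists_word_of_isCoarselyConnected h
  have hx : ∃ x, φ (Additive.ofMul (of x)) ≠ 0 := by
    by_contra! h0
    apply hφ
    have : AddMonoidHom.toMultiplicativeRight φ = 1 := FreeGroup.ext_hom _ _ fun x => h0 x
    exact AddMonoidHom.toMultiplicativeRight.injective this
  obtain ⟨x, hx⟩ := hx
  obtain ⟨y, hyx⟩ := exists_ne x
  -- A letter on which `φ` is negative, and one with another underlying generator on which it is not.
  have hinv : ∀ (a : α) (b : Bool),
      φ (Additive.ofMul (mk [(a, !b)])) = -φ (Additive.ofMul (mk [(a, b)])) := by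
    intro a b
    rw [← map_neg, ← ofMul_inv, inv_mk]
    rfl
  obtain ⟨b, hb⟩ : ∃ b, φ (Additive.ofMul (mk [(x, b)])) < 0 := by
    rcases lt_or_gt_of_ne hx with h | h
    · exact ⟨true, h⟩
    · exact ⟨false, by rw [← Bool.not_true, hinv]; exact neg_neg_of_pos h⟩
  obtain ⟨c, hc⟩ : ∃ c, 0 ≤ φ (Additive.ofMul (mk [(y, c)])) := by
    rcases le_total 0 (φ (Additive.ofMul (mk [(y, true)]))) with h | h
    · exact ⟨true, h⟩
    · exact ⟨false, by rw [← Bool.not_true, hinv]; simpa using h⟩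
  have hrep : ∀ (b : Bool) (N : ℕ), φ (Additive.ofMul (mk (List.replicate N (x, b)))) =
      N * φ (Additive.ofMul (mk [(x, b)])) := by
    intro b N
    rw [← ofMul_pow_apply, pow_mk]
    simp
  obtain ⟨N, hN⟩ := exists_nat_gt (C / φ (Additive.ofMul (mk [(x, b)])))
  rw [div_lt_iff_of_neg hb, ← hrep] at hN
  set W := List.replicate N (x, b) ++ (y, c) :: List.replicate N (x, !b) with hW
  have hφW : 0 ≤ φ (Additive.ofMul (mk W)) := by
    rw [hW, ← List.singleton_append, ← mul_mk, ← mul_mk]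
    simp only [ofMul_mul, map_add, hrep, hinv]
    linarith
  obtain ⟨L, hL, hLP⟩ := hC _ hφW
  have hW_red : IsReduced W := isReduced_replicate_append_cons_replicate hyx.symm b c N
  have hred : Red L W := by
    rw [← hW_red.reduce_eq, ← reduce.sound hL]
    exact reduce.red
  obtain ⟨P, hP, e⟩ := hred.exists_prefix_mk_eq (List.prefix_append (List.replicate N (x, b)) _)
  have := hLP P hP
  rw [e] at this
  linarith

end FreeGroup

/-! ### Virtual products of a free abelian and a free group -/

theorem IsVirtuallyFreeAbelianTimesFree.fg {n : ℕ} {G : Type*} [Group G]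
    (h : IsVirtuallyFreeAbelianTimesFree n G) : Group.FG G := by
  obtain ⟨k, -, H, hH, ⟨e⟩⟩ := h
  have : Group.FG (FreeAbelian n × FreeGroup (Fin k)) := inferInstance
  have : Group.FG H := Group.fg_of_surjective (f := e.symm.toMonoidHom) e.symm.surjective
  exact Group.fg_of_finiteIndex H

theorem IsVirtuallyFreeAbelianTimesFree.not_isCoarselyConnected {n : ℕ} {G : Type*} [Group G]
    (h : IsVirtuallyFreeAbelianTimesFree n G) {φ : Additive G →+ ℝ} (hφ : φ ≠ 0)
    (h0 : ∀ z ∈ Subgroup.center G, φ (Additive.ofMul z) = 0) : ¬ IsCoarselyConnected φ := by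
  obtain ⟨k, hk, H, hH, ⟨e⟩⟩ := h
  intro hcc
  have : Nontrivial (Fin k) := Fin.nontrivial_iff_two_le.2 hk
  let ψ : Additive (FreeGroup (Fin k)) →+ ℝ :=
    φ.comp (MonoidHom.toAdditive (H.subtype.comp (e.symm.toMonoidHom.comp (MonoidHom.inr _ _))))
  let f : H →* FreeGroup (Fin k) := (MonoidHom.snd _ _).comp e.toMonoidHom
  have hf : Function.Surjective f := Prod.snd_surjective.comp e.surjective
  have hψ : ∀ g : H, ψ (Additive.ofMul (f g)) = φ (Additive.ofMul (g : G)) := by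
    intro g
    obtain ⟨⟨v, w⟩, rfl⟩ := e.symm.surjective g
    have hv : φ (Additive.ofMul (e.symm (v, 1) : G)) = 0 := by
      refine apply_eq_zero_of_commute_of_finiteIndex H h0 fun x hx => ?_
      have hcomm : Commute (⟨x, hx⟩ : H) (e.symm (v, 1)) := by
        refine e.injective ?_
        rw [map_mul, map_mul, e.apply_symm_apply]
        exact Prod.ext (mul_comm _ _) (by simp)
      exact hcomm.map H.subtype
    have hsplit : ((v, w) : FreeAbelian n × FreeGroup (Fin k)) = (v, 1) * (1, w) := by simp
    have hfw : f (e.symm (v, w)) = w := by simp [f]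
    rw [hfw, hsplit, map_mul, Subgroup.coe_mul, ofMul_mul, map_add, hv, zero_add]
    rfl
  refine FreeGroup.not_isCoarselyConnected (φ := ψ) ?_ ((hcc.subgroup H).of_surjective hf hψ)
  rintro hψ0
  apply hφ
  ext g
  obtain ⟨m, hm, -, hmem⟩ :=
    Subgroup.exists_pow_mem_of_index_ne_zero (Subgroup.FiniteIndex.index_ne_zero (H := H)) g
  have := hψ ⟨_, hmem⟩
  rw [hψ0, ofMul_pow_apply] at this
  exact (mul_eq_zero.1 this.symm).resolve_left (by exact_mod_cast hm.ne')

theorem proposition3 (n : ℕ) (G : Type*) [Group G]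
    (hGBS : IsGBS n G) (hns : ¬ Group.IsSolvable G)
    (huni : IsVirtuallyFreeAbelianTimesFree n G) :
    bnsInvariant G = (subsphere G (Subgroup.center G : Set G))ᶜ := by
  have := huni.fg
  ext x
  induction x using Module.Ray.ind with
  | h φ hφ =>
    change rayOfNeZero ℝ φ hφ ∈ _ ↔ rayOfNeZero ℝ φ hφ ∈ _
    rw [Set.mem_compl_iff, mem_bnsInvariant_iff, mem_subsphere_iff]
    refine ⟨fun h h0 => huni.not_isCoarselyConnected hφ h0 h.isCoarselyConnected, fun h => ?_⟩
    push Not at h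
    obtain ⟨z, hz, h⟩ := h
    exact hasConnectedNonnegPart_of_mem_center hz h
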